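/- Let $V\in L^{3/2}(\mathbb{R}^3)$ be real-valued, let $\mu\in\mathbb{R}$ and $0<\beta<\infty$, and write $\hat\alpha(p)=(2\pi)^{-3/2}\int_{\mathbb{R}^3}\alpha(x)e^{-ip\cdot x}\,dx$ for the Fourier transform (extended unitarily to $L^2(\mathbb{R}^3)$). Let $\mathcal{D}$ be the set of pairs $(\gamma,\alpha)$ with $\gamma\in L^1(\mathbb{R}^3,(1+p^2)\,dp)$, $0\le\gamma\le 1$ a.e., $\alpha\in H^1(\mathbb{R}^3)$ (complex-valued), and $|\hat\alpha(p)|^2\le\gamma(p)(1-\gamma(p))$ for a.e. $p$. For $(\gamma,\alpha)\in\mathcal{D}$ define the BCS functional $$\mathcal{F}_\beta(\gamma,\alpha)=\int_{\mathbb{R}^3}(p^2-\mu)\gamma(p)\,dp+\int_{\mathbb{R}^3}|\alpha(x)|^2V(x)\,dx-\frac1\beta S(\gamma,\alpha),$$ $$S(\gamma,\alpha)=-\int_{\mathbb{R}^3}\big[s(p)\ln s(p)+(1-s(p))\ln(1-s(p))\big]\,dp,$$ where $s(p)$ is determined by $s(1-s)=\gamma(1-\gamma)-|\hat\alpha|^2$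 (the two solutions $s$ and $1-s$ give the same integrand) and $0\ln 0=0$. If $(\gamma,\alpha)\in\mathcal{D}$ is a minimizer of $\mathcal{F}_\beta$ over $\mathcal{D}$, then both $\gamma$ and $\hat\alpha$ are continuous functions on $\mathbb{R}^3$, i.e. each of them agrees almost everywhere with a continuous function. -/

import Mathlib

open MeasureTheory FourierTransform

noncomputable section

/-- Three-dimensional Euclidean space, used both for positions and for momenta. -/
abbrev E3 : Type := EuclideanSpace ℝ (Fin 3)

/-- Complex `L²(ℝ³)` with respect to Lebesgue measure. -/
abbrev L2C : Type := Lp (α := E3) ℂ 2 volume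

/-- The Fourier transform in the convention `(2π)^(-3/2) ∫ α(x) exp(-i p·x) dx`, extended to
`L²(ℝ³)`. Mathlib's `𝓕` is the unitary extension to `L²` of `f ↦ ∫ f(x) exp(-2πi ξ·x) dx`, so it is
evaluated at `ξ = p / (2π)`. As for any element of `L²`, values are meaningful almost everywhere. -/
def fourierHat (α : L2C) (p : E3) : ℂ :=
  (((2 * Real.pi) ^ (-(3 / 2) : ℝ) : ℝ) : ℂ) * (𝓕 α : L2C) ((2 * Real.pi)⁻¹ • p)

/-- The set of admissible pairs `(γ, α)`: `γ ∈ L¹(ℝ³, (1 + p²) dp)`, `0 ≤ γ ≤ 1`, `α ∈ H¹(ℝ³)`, and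
`|α̂|² ≤ γ (1 - γ)`, all pointwise conditions being understood almost everywhere. -/
def bcsDomain : Set ((E3 → ℝ) × L2C) :=
  {x | Integrable (fun p : E3 => (1 + ‖p‖ ^ 2) * x.1 p) volume ∧
    (∀ᵐ p : E3 ∂volume, 0 ≤ x.1 p ∧ x.1 p ≤ 1) ∧
    TemperedDistribution.MemSobolev 1 2 (Lp.toTemperedDistribution x.2) ∧
    ∀ᵐ p : E3 ∂volume, ‖fourierHat x.2 p‖ ^ 2 ≤ x.1 p * (1 - x.1 p)}

/-- The solution `s ≤ 1/2` of `s (1 - s) = g (1 - g) - |a|²`; the other one is `1 - s`. -/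
def bcsS (g : ℝ) (a : ℂ) : ℝ := 1 / 2 - √((g - 1 / 2) ^ 2 + ‖a‖ ^ 2)

theorem bcsS_spec (g : ℝ) (a : ℂ) :
    bcsS g a * (1 - bcsS g a) = g * (1 - g) - ‖a‖ ^ 2 := by
  have h : √((g - 1 / 2) ^ 2 + ‖a‖ ^ 2) ^ 2 = (g - 1 / 2) ^ 2 + ‖a‖ ^ 2 :=
    Real.sq_sqrt (by positivity)
  unfold bcsS
  linear_combination (-1) * h

theorem bcsS_mem_Icc (g : ℝ) (a : ℂ) (h : ‖a‖ ^ 2 ≤ g * (1 - g)) :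
    bcsS g a ∈ Set.Icc (0 : ℝ) (1 / 2) := by
  have h0 := Real.sqrt_nonneg ((g - 1 / 2) ^ 2 + ‖a‖ ^ 2)
  have h1 : √((g - 1 / 2) ^ 2 + ‖a‖ ^ 2) ≤ 1 / 2 :=
    Real.sqrt_le_iff.2 ⟨by norm_num, by nlinarith⟩
  unfold bcsS
  constructor <;> linarith

/-- `s log s + (1 - s) log (1 - s)`, with `0 log 0 = 0`. -/
def entropyDensity (s : ℝ) : ℝ := s * Real.log s + (1 - s) * Real.log (1 - s)

/-- The choice of the root `s` does not affect the entropy. -/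
theorem entropyDensity_eq_of_root (g : ℝ) (a : ℂ) (s : ℝ)
    (hs : s * (1 - s) = g * (1 - g) - ‖a‖ ^ 2) :
    entropyDensity s = entropyDensity (bcsS g a) := by
  have h : (s - bcsS g a) * (1 - s - bcsS g a) = 0 := by
    linear_combination hs - bcsS_spec g a
  rcases mul_eq_zero.1 h with h | h
  · rw [sub_eq_zero.1 h]
  · have h' : bcsS g a = 1 - s := by linarith
    rw [h', entropyDensity, entropyDensity, sub_sub_cancel, add_comm]

/-- The entropy `S(γ, α)`. -/
def bcsEntropy (γ : E3 → ℝ) (α : L2C) : ℝ :=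
  -∫ p : E3, entropyDensity (bcsS (γ p) (fourierHat α p))

/-- The BCS functional `F_β(γ, α)` with interaction potential `V` and chemical potential `μ`. -/
def bcsFunctional (V : E3 → ℝ) (μ β : ℝ) (γ : E3 → ℝ) (α : L2C) : ℝ :=
  (∫ p : E3, (‖p‖ ^ 2 - μ) * γ p) + (∫ x : E3, ‖α x‖ ^ 2 * V x) - 1 / β * bcsEntropy γ α

end

/-! Encode a pair at momentum `p` by the vector `v = (γ - 1/2, α̂)` in `ℝ × ℂ`, the traceless part
of the 2×2 density matrix. Then `s = 1/2 - ‖v‖`, the pointwise constraints say exactly `‖v‖ ≤ 1/2`,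
and the negative entropy density is a convex function `φ(‖v‖)`. So the functional is linear in the
kinetic part, quadratic in the potential part and convex in the entropy part, over a convex domain.

Moving from a minimizer along a segment towards a competitor `v₁` and bounding the entropy by
convexity, without differentiating it, gives `0 ≤ ∫ (h(v₁) - h(v))`, where `h(u) = ⟪w, u⟫ + β⁻¹
φ(‖u‖)`, `w = (p² - μ, Δ)` and `Δ = 2 (Vα)^`. On a ball of momenta take `v₁` to be the unique
pointwise minimizer of `h`, and keep `v₁ = v` outside. The integrand is then nonpositive, and
negative on the ball wherever `v ≠ v₁`; hence `v = v₁` almost everywhere there (`gibbs_lt`,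
`linearized_bcsFunctional_nonneg`, `ae_eq_gibbsPoint_of_norm_le`).

The minimizer of `h` has norm `tanh(β‖w‖/2)/2` and direction `-w`, so it depends continuously on
`w`, also at `w = 0`. Finally `w` is continuous in `p`: by Sobolev `α ∈ L² ∩ L⁶ ⊂ L³`, so `Vα ∈ L¹`
by Hölder, and the Fourier transform of an `L¹` function is continuous. -/

section

open scoped SchwartzMap LineDeriv ENNReal NNReal Topology

/-! ### The Sobolev embedding of `H¹`, by Schwartz approximation. -/

namespace SchwartzMap

variable {E : Type*} [NormedAddCommGroup E] [InnerProductSpace ℝ E] [FiniteDimensional ℝ E]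
  [MeasurableSpace E] [BorelSpace E]

/-- Plancherel turns the operator into multiplication by `m`. -/
theorem norm_toLp_fourierMultiplierCLM_le {m : E → ℂ} (hm : m.HasTemperateGrowth) {C : ℝ}
    (hC : ∀ x, ‖m x‖ ≤ C) (g : 𝓢(E, ℂ)) :
    ‖(fourierMultiplierCLM ℂ m g).toLp 2‖ ≤ C * ‖g.toLp 2‖ := by
  rw [fourierMultiplierCLM_apply, ← norm_fourier_toL2_eq (𝓕⁻ _), fourier_fourierInv_eq,
    ← norm_fourier_toL2_eq g]
  refine Lp.norm_le_mul_norm_of_ae_le_mul ?_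
  filter_upwards [coeFn_toLp (smulLeftCLM ℂ m (𝓕 g)) 2, coeFn_toLp (𝓕 g) 2] with x h1 h2
  rw [h1, h2, smulLeftCLM_apply_apply hm, norm_smul]
  exact mul_le_mul_of_nonneg_right (hC x) (norm_nonneg _)

omit [FiniteDimensional ℝ E] [MeasurableSpace E] [BorelSpace E] in
theorem norm_fderiv_le_sum {ι : Type*} [Fintype ι] (b : OrthonormalBasis ι ℝ E) (f : 𝓢(E, ℂ))
    (x : E) : ‖fderiv ℝ f x‖ ≤ ∑ i, ‖(∂_{b i} f : 𝓢(E, ℂ)) x‖ := by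
  refine ContinuousLinearMap.opNorm_le_bound _ (by positivity) fun y => ?_
  conv_lhs => rw [← b.sum_repr y]
  rw [map_sum, Finset.sum_mul]
  refine (norm_sum_le _ _).trans (Finset.sum_le_sum fun i _ => ?_)
  rw [map_smul, norm_smul, mul_comm, lineDerivOp_apply_eq_fderiv]
  gcongr
  rw [b.repr_apply_apply]
  simpa using norm_inner_le_norm (𝕜 := ℝ) (b i) y

theorem eLpNorm_le_of_norm_le_sum {ι G : Type*} [Fintype ι] [NormedAddCommGroup G] {F : E → G}
    (D : ι → 𝓢(E, ℂ)) (hF : ∀ x, ‖F x‖ ≤ ∑ i, ‖D i x‖) {C : ℝ} (hC : ∀ i, ‖(D i).toLp 2‖ ≤ C) :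
    eLpNorm F 2 volume ≤ ENNReal.ofReal (Fintype.card ι * C) := by
  have hn (i) : AEStronglyMeasurable (fun x => ‖D i x‖) volume :=
    (D i).continuous.norm.aestronglyMeasurable
  have hD (i) : eLpNorm (D i) 2 volume ≤ ENNReal.ofReal C := by
    have h := hC i
    rw [norm_toLp] at h
    rw [← ENNReal.ofReal_toReal ((D i).memLp 2 volume).eLpNorm_ne_top]
    exact ENNReal.ofReal_le_ofReal h
  calc eLpNorm F 2 volume
      ≤ eLpNorm (∑ i, fun x => ‖D i x‖) 2 volume := by
        refine eLpNorm_mono_real fun x => ?_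
        simpa using hF x
    _ ≤ ∑ i, eLpNorm (fun x => ‖D i x‖) 2 volume :=
        eLpNorm_sum_le (fun i _ => hn i) one_le_two
    _ ≤ ∑ _i : ι, ENNReal.ofReal C := by
        refine Finset.sum_le_sum fun i _ => ?_
        rw [eLpNorm_norm]
        exact hD i
    _ = _ := by
        rw [Finset.sum_const, Finset.card_univ, nsmul_eq_mul,
          ENNReal.ofReal_mul (by positivity), ENNReal.ofReal_natCast]

theorem eLpNorm_fderiv_le_of_forall {f : 𝓢(E, ℂ)} {C : ℝ}
    (hC : ∀ m : E, ‖(∂_{m} f : 𝓢(E, ℂ)).toLp 2‖ ≤ C * ‖m‖) :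
    eLpNorm (fderiv ℝ f) 2 volume ≤ ENNReal.ofReal (Module.finrank ℝ E * C) := by
  have b := stdOrthonormalBasis ℝ E
  have h := eLpNorm_le_of_norm_le_sum (C := C) (F := fderiv ℝ f)
    (fun i => (∂_{b i} f : 𝓢(E, ℂ))) (norm_fderiv_le_sum b f)
    (fun i => by have h := hC (b i); rwa [b.norm_eq_one, mul_one] at h)
  rwa [Fintype.card_fin] at h

end SchwartzMap

section Sobolev

variable {E : Type*} [NormedAddCommGroup E] [InnerProductSpace ℝ E] [FiniteDimensional ℝ E]
  [MeasurableSpace E] [BorelSpace E]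

open TemperedDistribution Filter

/-- Write `α` as the multiplier `(1 + ‖ξ‖²)^(-1/2)` applied to some `f ∈ L²`, and apply the same
multiplier to Schwartz approximations of `f`. Its symbol is bounded by 1, which gives convergence;
after a derivative in direction `m` the symbol is bounded by `2π‖m‖`, which gives the uniform
gradient bound. -/
theorem TemperedDistribution.MemSobolev.exists_seq_schwartzMap {α : Lp (α := E) ℂ 2 volume}
    (hα : MemSobolev 1 2 (Lp.toTemperedDistribution α)) :
    ∃ (u : ℕ → 𝓢(E, ℂ)) (C : ℝ), Tendsto (fun n => (u n).toLp 2) atTop (𝓝 α) ∧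
      ∀ (n : ℕ) (m : E), ‖(∂_{m} (u n) : 𝓢(E, ℂ)).toLp 2‖ ≤ C * ‖m‖ := by
  obtain ⟨f, hf⟩ := hα
  obtain ⟨g, hg⟩ : ∃ g : ℕ → 𝓢(E, ℂ), Tendsto (fun n => (g n).toLp 2) atTop (𝓝 f) := by
    have hd := SchwartzMap.denseRange_toLpCLM (E := E) (F := ℂ) (p := 2) (μ := volume)
      ENNReal.ofNat_ne_top
    obtain ⟨x, hx, hxl⟩ := mem_closure_iff_seq_limit.1 (hd f)
    choose g hg using hx
    exact ⟨g, by convert hxl using 1; ext1 n; exact hg n⟩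
  let b : E → ℝ := fun x => (1 + ‖x‖ ^ 2) ^ (-1 / 2 : ℝ)
  have hb : b.HasTemperateGrowth := by fun_prop
  let bc : E → ℂ := fun x => (b x : ℂ)
  have hbc : bc.HasTemperateGrowth := by fun_prop
  have hb1 : ∀ x, ‖bc x‖ ≤ 1 := fun x => by
    rw [Complex.norm_real, Real.norm_eq_abs, abs_of_nonneg (by positivity)]
    exact Real.rpow_le_one_of_one_le_of_nonpos (by simp) (by norm_num)
  let u : ℕ → 𝓢(E, ℂ) := fun n => SchwartzMap.fourierMultiplierCLM ℂ bc (g n)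
  have hα' : TemperedDistribution.fourierMultiplierCLM ℂ bc (Lp.toTemperedDistribution f) =
      Lp.toTemperedDistribution α := by
    rw [← hf]
    have := besselPotential_besselPotential_apply 1 (-1) (Lp.toTemperedDistribution α)
    rw [add_neg_cancel, besselPotential_zero] at this
    exact this
  obtain ⟨α', hα2⟩ : ∃ α', Tendsto (fun n => (u n).toLp 2 : ℕ → Lp (α := E) ℂ 2 volume)
      atTop (𝓝 α') := by
    refine cauchySeq_tendsto_of_complete ?_
    rw [Metric.cauchySeq_iff']
    intro ε hε
    obtain ⟨N, hN⟩ := Metric.cauchySeq_iff'.1 hg.cauchySeq ε hε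
    refine ⟨N, fun n hn => ?_⟩
    refine lt_of_le_of_lt ?_ (hN n hn)
    rw [dist_eq_norm, dist_eq_norm]
    have := SchwartzMap.norm_toLp_fourierMultiplierCLM_le hbc hb1 (g n - g N)
    rw [map_sub, one_mul] at this
    have h2 := fun f g : 𝓢(E, ℂ) => map_sub (SchwartzMap.toLpCLM ℂ (E := E) ℂ 2 volume) f g
    simp only [SchwartzMap.toLpCLM_apply] at h2
    rwa [h2, h2] at this
  -- The limit is identified among tempered distributions, where the multiplier is continuous and
  -- into which `L²` embeds injectively.
  have hαα : α' = α := by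
    have h0 : Function.Injective (Lp.toTemperedDistributionCLM (E := E) ℂ volume 2) := by
      rw [← ContinuousLinearMap.coe_coe, ← LinearMap.ker_eq_bot]
      exact Lp.ker_toTemperedDistributionCLM_eq_bot
    apply h0
    have h1 := ((Lp.toTemperedDistributionCLM (E := E) ℂ volume 2).continuous.tendsto _).comp hα2
    have h2 := (((TemperedDistribution.fourierMultiplierCLM ℂ bc).comp
      (Lp.toTemperedDistributionCLM (E := E) ℂ volume 2)).continuous.tendsto _).comp hg
    refine tendsto_nhds_unique h1 ?_
    convert! h2 using 1
    · ext1 n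
      simp only [Function.comp_apply, ContinuousLinearMap.comp_apply,
        Lp.toTemperedDistributionCLM_apply, Lp.toTemperedDistribution_toLp_eq]
      rw [fourierMultiplierCLM_toTemperedDistributionCLM_eq hbc]
    · simp [hα']
  rw [hαα] at hα2
  obtain ⟨M, hM⟩ := (Metric.isBounded_range_of_tendsto _ hg).exists_norm_le
  refine ⟨u, 2 * Real.pi * M, hα2, fun n m => ?_⟩
  have hi : (fun x : E => (inner ℝ x m : ℝ)).HasTemperateGrowth := by fun_prop
  have h3 : (∂_{m} (u n) : 𝓢(E, ℂ)) = (2 * Real.pi * Complex.I : ℂ) •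
      SchwartzMap.fourierMultiplierCLM ℂ ((fun x : E => ((inner ℝ x m : ℝ) : ℂ)) * bc) (g n) := by
    rw [SchwartzMap.lineDeriv_eq_fourierMultiplierCLM,
      ← SchwartzMap.fourierMultiplierCLM_ofReal ℂ hi,
      ← SchwartzMap.fourierMultiplierCLM_fourierMultiplierCLM_apply (by fun_prop) hbc]
    rfl
  have h4 := SchwartzMap.norm_toLp_fourierMultiplierCLM_le
    (m := (fun x : E => ((inner ℝ x m : ℝ) : ℂ)) * bc) (C := ‖m‖) (by fun_prop) (fun x => by
      rw [Pi.mul_apply, norm_mul, Complex.norm_real, Complex.norm_real, Real.norm_eq_abs,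
        Real.norm_eq_abs]
      have h5 := abs_real_inner_le_norm x m
      have h6 : 0 ≤ b x := by positivity
      have h7 : ‖x‖ * b x ≤ 1 := by
        have : b x * b x = (1 + ‖x‖ ^ 2)⁻¹ := by
          simp only [b]
          rw [← Real.rpow_add (by positivity), ← Real.rpow_neg_one]
          norm_num
        refine abs_le_one_iff_mul_self_le_one.2 ?_ |> fun h => (le_abs_self _).trans h
        rw [mul_mul_mul_comm, this, ← div_eq_mul_inv, div_le_one (by positivity)]
        nlinarith
      rw [abs_of_nonneg h6]
      calc |inner ℝ x m| * b x ≤ ‖x‖ * ‖m‖ * b x := by gcongr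
        _ = ‖m‖ * (‖x‖ * b x) := by ring
        _ ≤ ‖m‖ * 1 := by gcongr
        _ = ‖m‖ := mul_one _) (g n)
  rw [h3]
  have h8 := fun (c : ℂ) (f : 𝓢(E, ℂ)) =>
    map_smul (SchwartzMap.toLpCLM ℂ (E := E) ℂ 2 volume) c f
  simp only [SchwartzMap.toLpCLM_apply] at h8
  rw [h8, norm_smul]
  have h9 : ‖(2 * Real.pi * Complex.I : ℂ)‖ = 2 * Real.pi := by
    simp [abs_of_pos Real.pi_pos]
  rw [h9, mul_assoc (2 * Real.pi)]
  refine mul_le_mul_of_nonneg_left (h4.trans ?_) (by positivity)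
  rw [mul_comm]
  refine mul_le_mul_of_nonneg_right ?_ (norm_nonneg _)
  exact hM _ ⟨n, rfl⟩

/-- The Gagliardo–Nirenberg–Sobolev inequality is applied to compactly supported functions, hence
the cutoffs `χ(x / (k + 1))`. Their gradients are bounded uniformly in `k`, so `K` depends neither
on `k` nor on `f`. -/
theorem exists_eLpNorm_cutoff_smul_le (E : Type*) [NormedAddCommGroup E] [InnerProductSpace ℝ E]
    [FiniteDimensional ℝ E] [MeasurableSpace E] [BorelSpace E] [Nontrivial E] {p : ℝ≥0}
    (hp : (p : ℝ)⁻¹ = 2⁻¹ - (Module.finrank ℝ E : ℝ)⁻¹) :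
    ∃ (χ : ℕ → E → ℝ) (K : ℝ≥0), (∀ k, Continuous (χ k)) ∧
      (∀ x, Tendsto (fun k => χ k x) atTop (𝓝 1)) ∧
      ∀ (k : ℕ) (f : 𝓢(E, ℂ)), eLpNorm (fun x => χ k x • f x) p volume ≤
        K * (eLpNorm (fderiv ℝ f) 2 volume + K * eLpNorm f 2 volume) := by
  let χ : ContDiffBump (0 : E) := ⟨1, 2, one_pos, one_lt_two⟩
  have hχ : ContDiff ℝ 1 χ := χ.contDiff
  obtain ⟨C, hC⟩ := (χ.hasCompactSupport.fderiv ℝ).exists_bound_of_continuous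
    (hχ.continuous_fderiv one_ne_zero)
  have hC0 : 0 ≤ C := (norm_nonneg _).trans (hC 0)
  let S := SNormLESNormFDerivOfEqConst ℂ (volume : Measure E) 2
  have hk (k : ℕ) : (0 : ℝ) < (k + 1 : ℝ)⁻¹ := by positivity
  have hcd (k : ℕ) : ContDiff ℝ 1 (fun x : E => χ ((k + 1 : ℝ)⁻¹ • x)) :=
    hχ.comp (contDiff_const_smul _)
  refine ⟨fun k x => χ ((k + 1 : ℝ)⁻¹ • x), max S C.toNNReal, fun k => (hcd k).continuous,
    fun x => ?_, fun k f => ?_⟩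
  · refine tendsto_const_nhds.congr' ?_
    have h0 : Tendsto (fun k : ℕ => (k + 1 : ℝ)⁻¹ • x) atTop (𝓝 0) := by
      have := (tendsto_one_div_add_atTop_nhds_zero_nat (𝕜 := ℝ)).smul_const x
      simpa using this
    filter_upwards [h0.eventually χ.eventuallyEq_one] with k hk
    exact hk.symm
  have hf : ContDiff ℝ 1 f := f.smooth 1
  have hcs : HasCompactSupport (fun x => χ ((k + 1 : ℝ)⁻¹ • x) • f x) :=
    (χ.hasCompactSupport.comp_smul (hk k).ne').smul_right
  have hfd (x : E) : ‖fderiv ℝ (fun x => χ ((k + 1 : ℝ)⁻¹ • x) • f x) x‖ ≤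
      ‖fderiv ℝ f x‖ + C * ‖f x‖ := by
    rw [fderiv_fun_smul ((hcd k).differentiable one_ne_zero x) (hf.differentiable one_ne_zero x)]
    refine (norm_add_le _ _).trans (add_le_add ?_ ?_)
    · rw [norm_smul, Real.norm_eq_abs, abs_of_nonneg χ.nonneg]
      exact mul_le_of_le_one_left (norm_nonneg _) χ.le_one
    · rw [ContinuousLinearMap.norm_smulRight_apply, fderiv_comp_smul, norm_smul, Real.norm_eq_abs,
        abs_of_pos (hk k)]
      refine mul_le_mul_of_nonneg_right ?_ (norm_nonneg _)
      refine (mul_le_of_le_one_left (norm_nonneg _) ?_).trans (hC _)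
      exact inv_le_one_of_one_le₀ (by simp)
  have hm1 : AEStronglyMeasurable (fun x => ‖fderiv ℝ f x‖) volume :=
    (hf.continuous_fderiv one_ne_zero).norm.aestronglyMeasurable
  have hm2 : AEStronglyMeasurable (fun x => C * ‖f x‖) volume :=
    (f.continuous.norm.const_mul C).aestronglyMeasurable
  calc _ ≤ S * eLpNorm (fderiv ℝ fun x => χ ((k + 1 : ℝ)⁻¹ • x) • f x) (2 : ℝ≥0) volume :=
        eLpNorm_le_eLpNorm_fderiv_of_eq volume ((hcd k).smul hf) hcs one_le_two
          Module.finrank_pos (by simpa using hp)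
    _ ≤ S * (eLpNorm (fderiv ℝ f) 2 volume + C.toNNReal * eLpNorm f 2 volume) := by
        gcongr
        refine (eLpNorm_mono_real hfd).trans ?_
        refine (eLpNorm_add_le hm1 hm2 one_le_two).trans ?_
        gcongr
        · exact (eLpNorm_norm _).le
        · refine (eLpNorm_const_smul_le (c := C) (f := fun x => ‖f x‖)).trans ?_
          rw [eLpNorm_norm]
          gcongr
          rw [Real.enorm_of_nonneg hC0]
          rfl
    _ ≤ _ := by
        gcongr
        · exact le_max_left _ _
        · exact le_max_right _ _

/-- The Sobolev embedding `H¹ ⊂ Lᵖ`, `1 / p = 1 / 2 - 1 / d`. -/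
theorem TemperedDistribution.MemSobolev.memLp [Nontrivial E] {p : ℝ≥0}
    (hp : (p : ℝ)⁻¹ = 2⁻¹ - (Module.finrank ℝ E : ℝ)⁻¹) {α : Lp (α := E) ℂ 2 volume}
    (hα : MemSobolev 1 2 (Lp.toTemperedDistribution α)) : MemLp α p volume := by
  obtain ⟨u, C, hu, hC⟩ := hα.exists_seq_schwartzMap
  obtain ⟨χ, K, hχc, hχ, hK⟩ := exists_eLpNorm_cutoff_smul_le E hp
  obtain ⟨M, hM⟩ := (Metric.isBounded_range_of_tendsto _ hu).exists_norm_le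
  obtain ⟨ns, hns, hae⟩ := (tendstoInMeasure_of_tendsto_Lp hu).exists_seq_tendsto_ae
  refine ⟨(Lp.memLp α).1, ?_⟩
  have hb (k : ℕ) : eLpNorm (fun x => χ k x • u (ns k) x) p volume ≤
      K * (ENNReal.ofReal (Module.finrank ℝ E * C) + K * ENNReal.ofReal M) := by
    refine (hK k (u (ns k))).trans ?_
    gcongr
    · exact SchwartzMap.eLpNorm_fderiv_le_of_forall (hC (ns k))
    · have h := hM _ ⟨ns k, rfl⟩
      rw [SchwartzMap.norm_toLp] at h
      rw [← ENNReal.ofReal_toReal ((u (ns k)).memLp 2 volume).eLpNorm_ne_top]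
      exact ENNReal.ofReal_le_ofReal h
  have hm (k : ℕ) : AEStronglyMeasurable (fun x => χ k x • u (ns k) x) volume :=
    ((hχc k).smul (u (ns k)).continuous).aestronglyMeasurable
  have hl : ∀ᵐ x ∂volume, Tendsto (fun k => χ k x • u (ns k) x) atTop (𝓝 (α x)) := by
    have h1 : ∀ᵐ x ∂volume, ∀ n, (u n).toLp 2 volume x = u n x :=
      ae_all_iff.2 fun n => (u n).coeFn_toLp 2 volume
    filter_upwards [hae, h1] with x hx h1
    simp only [h1] at hx
    simpa using (hχ x).smul hx
  -- Fatou along the diagonal sequence, where the cutoff and the approximation advance together.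
  refine (Lp.eLpNorm_lim_le_liminf_eLpNorm hm _ hl).trans_lt ?_
  refine (liminf_le_of_frequently_le' (Frequently.of_forall hb)).trans_lt ?_
  finiteness

end Sobolev

end

/-! ### Convex analysis of the entropy and the pointwise minimization problem. -/

noncomputable section

open Set Filter
open scoped Topology RealInnerProductSpace

/-- The negative entropy as a function of the distance `r` of `s` from `1 / 2`. -/
def radialEntropy (r : ℝ) : ℝ := entropyDensity (1 / 2 - r)

theorem entropyDensity_eq_neg_binEntropy (s : ℝ) : entropyDensity s = -Real.binEntropy s := by
  simp only [entropyDensity, Real.binEntropy, Real.log_inv]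
  ring

theorem radialEntropy_eq (r : ℝ) : radialEntropy r = -Real.binEntropy (1 / 2 - r) :=
  entropyDensity_eq_neg_binEntropy _

theorem continuous_radialEntropy : Continuous radialEntropy := by
  have : radialEntropy = fun r => -Real.binEntropy (1 / 2 - r) := funext radialEntropy_eq
  rw [this]
  fun_prop

theorem strictConvexOn_radialEntropy :
    StrictConvexOn ℝ (Icc (-(1 / 2)) (1 / 2)) radialEntropy := by
  refine ⟨convex_Icc _ _, fun x hx y hy hxy a b ha hb hab => ?_⟩
  have h := Real.strictConcave_binEntropy.2 (x := 1 / 2 - x) (y := 1 / 2 - y)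
    ⟨by linarith [hx.2], by linarith [hx.1]⟩ ⟨by linarith [hy.2], by linarith [hy.1]⟩
    (by simpa using hxy) ha hb hab
  simp only [radialEntropy_eq, smul_eq_mul] at h ⊢
  have h2 : a * (1 / 2 - x) + b * (1 / 2 - y) = 1 / 2 - (a * x + b * y) := by
    linear_combination (1 / 2) * hab
  rw [h2] at h
  linarith

theorem monotoneOn_radialEntropy : MonotoneOn radialEntropy (Icc 0 (1 / 2)) := by
  intro x hx y hy hxy
  rw [radialEntropy_eq, radialEntropy_eq]
  refine neg_le_neg (Real.binEntropy_strictMonoOn.monotoneOn ?_ ?_ (by linarith))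
  · exact ⟨by linarith [hy.2], by linarith [hy.1]⟩
  · exact ⟨by linarith [hx.2], by linarith [hx.1]⟩

/-- The inverse of the derivative of `radialEntropy`, i.e. `tanh (t / 2) / 2`. -/
def gibbsRadius (t : ℝ) : ℝ := 1 / 2 - (Real.exp t + 1)⁻¹

theorem continuous_gibbsRadius : Continuous gibbsRadius :=
  continuous_const.sub ((Real.continuous_exp.add continuous_const).inv₀
    fun t => (by positivity : Real.exp t + 1 ≠ 0))

theorem gibbsRadius_zero : gibbsRadius 0 = 0 := by norm_num [gibbsRadius]

theorem gibbsRadius_mem_Ioo (t : ℝ) : gibbsRadius t ∈ Ioo (-(1 / 2) : ℝ) (1 / 2) := by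
  have h0 : 0 < (Real.exp t + 1)⁻¹ := by positivity
  have h1 : (Real.exp t + 1)⁻¹ < 1 := inv_lt_one_of_one_lt₀ (by linarith [Real.exp_pos t])
  constructor <;> (unfold gibbsRadius; linarith)

theorem gibbsRadius_nonneg {t : ℝ} (ht : 0 ≤ t) : 0 ≤ gibbsRadius t := by
  have h1 : (Real.exp t + 1)⁻¹ ≤ 2⁻¹ :=
    inv_anti₀ two_pos (by linarith [Real.one_le_exp ht])
  unfold gibbsRadius
  linarith

/-- With `s = 1/2 - r`, the derivative is `log ((1 - s) / s)`, which equals `t` exactly when `s =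
(exp t + 1)⁻¹`. -/
theorem hasDerivAt_radialEntropy_gibbsRadius (t : ℝ) :
    HasDerivAt radialEntropy t (gibbsRadius t) := by
  have hpos : 0 < Real.exp t + 1 := by positivity
  have h1 : (1 / 2 - gibbsRadius t) = (Real.exp t + 1)⁻¹ := by unfold gibbsRadius; ring
  have h2 : 1 - (Real.exp t + 1)⁻¹ = Real.exp t * (Real.exp t + 1)⁻¹ := by field_simp; ring
  have h := Real.hasDerivAt_binEntropy (p := (Real.exp t + 1)⁻¹) (by positivity)
    (by have := inv_lt_one_of_one_lt₀ (a := Real.exp t + 1) (by linarith [Real.exp_pos t])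
        exact this.ne)
  rw [h2, Real.log_mul (by positivity) (by positivity), Real.log_exp, add_sub_cancel_right, ← h1]
    at h
  have h3 := (h.comp_const_sub (1 / 2) (gibbsRadius t)).neg
  rw [neg_neg] at h3
  have h4 : radialEntropy = -fun r => Real.binEntropy (1 / 2 - r) := funext radialEntropy_eq
  rw [h4]
  exact h3

/-- A strictly convex function lies strictly above its tangents. The point of tangency is interior,
so `r` may be an endpoint, where the entropy has infinite slope. -/
theorem tangent_lt_radialEntropy {t r : ℝ} (hr : r ∈ Icc (-(1 / 2) : ℝ) (1 / 2))
    (hne : r ≠ gibbsRadius t) :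
    radialEntropy (gibbsRadius t) + t * (r - gibbsRadius t) < radialEntropy r := by
  have hm := Ioo_subset_Icc_self (gibbsRadius_mem_Ioo t)
  have hd := hasDerivAt_radialEntropy_gibbsRadius t
  rcases hne.lt_or_gt with h | h
  · have := strictConvexOn_radialEntropy.slope_lt_of_hasDerivAt hr hm h hd
    rw [slope_def_field, div_lt_iff₀ (by linarith)] at this
    linarith
  · have := strictConvexOn_radialEntropy.lt_slope_of_hasDerivAt hm hr h hd
    rw [slope_def_field, lt_div_iff₀ (by linarith)] at this
    linarith

section InnerProductSpace

variable {W : Type*} [NormedAddCommGroup W] [InnerProductSpace ℝ W]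

/-- An increasing convex function of a norm is convex; monotonicity is available on `[0, 1/2]`. -/
theorem convexOn_radialEntropy_norm :
    ConvexOn ℝ (Metric.closedBall (0 : W) (1 / 2)) fun v => radialEntropy ‖v‖ := by
  refine ⟨convex_closedBall _ _, fun x hx y hy a b ha hb hab => ?_⟩
  rw [mem_closedBall_zero_iff] at hx hy
  have hn : ‖a • x + b • y‖ ≤ a * ‖x‖ + b * ‖y‖ := by
    refine (norm_add_le _ _).trans_eq ?_
    rw [norm_smul, norm_smul, Real.norm_of_nonneg ha, Real.norm_of_nonneg hb]
  have hle : a * ‖x‖ + b * ‖y‖ ≤ 1 / 2 := by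
    calc a * ‖x‖ + b * ‖y‖ ≤ a * (1 / 2) + b * (1 / 2) := by gcongr
      _ = 1 / 2 := by rw [← add_mul, hab, one_mul]
  refine (monotoneOn_radialEntropy ⟨norm_nonneg _, hn.trans hle⟩ ⟨by positivity, hle⟩ hn).trans ?_
  exact strictConvexOn_radialEntropy.convexOn.2 ⟨by linarith [norm_nonneg x], hx⟩
    ⟨by linarith [norm_nonneg y], hy⟩ ha hb hab

/-- The minimizer of `v ↦ ⟪w, v⟫ + β⁻¹ radialEntropy ‖v‖` on the ball of radius `1 / 2`. -/
def gibbsPoint (β : ℝ) (w : W) : W := -(gibbsRadius (β * ‖w‖) / ‖w‖) • w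

theorem norm_gibbsPoint {β : ℝ} (hβ : 0 < β) (w : W) :
    ‖gibbsPoint β w‖ = gibbsRadius (β * ‖w‖) := by
  rcases eq_or_ne w 0 with rfl | hw
  · simp [gibbsPoint, gibbsRadius_zero]
  · have h := gibbsRadius_nonneg (by positivity : 0 ≤ β * ‖w‖)
    rw [gibbsPoint, norm_smul, norm_neg, norm_div, norm_norm, Real.norm_of_nonneg h,
      div_mul_cancel₀ _ (norm_ne_zero_iff.2 hw)]

theorem norm_gibbsPoint_le {β : ℝ} (hβ : 0 < β) (w : W) : ‖gibbsPoint β w‖ ≤ 1 / 2 := by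
  rw [norm_gibbsPoint hβ]
  exact (gibbsRadius_mem_Ioo _).2.le

theorem inner_gibbsPoint (β : ℝ) (w : W) :
    ⟪w, gibbsPoint β w⟫ = -(gibbsRadius (β * ‖w‖) * ‖w‖) := by
  rcases eq_or_ne w 0 with rfl | hw
  · simp
  · have := norm_ne_zero_iff.2 hw
    rw [gibbsPoint, inner_smul_right, real_inner_self_eq_norm_sq]
    field_simp

/-- Only `w = 0` is delicate, because of the division by `‖w‖`; there the norm `gibbsRadius (β *
‖w‖)` tends to 0. -/
theorem continuous_gibbsPoint {β : ℝ} (hβ : 0 < β) : Continuous (gibbsPoint β : W → W) := by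
  have hc : Continuous fun w : W => gibbsRadius (β * ‖w‖) :=
    continuous_gibbsRadius.comp (continuous_const.mul continuous_norm)
  rw [continuous_iff_continuousAt]
  intro w
  rcases eq_or_ne w 0 with rfl | hw
  · have h0 : gibbsPoint β (0 : W) = 0 := by simp [gibbsPoint]
    rw [ContinuousAt, h0, tendsto_zero_iff_norm_tendsto_zero]
    simp only [norm_gibbsPoint hβ]
    simpa [gibbsRadius_zero] using hc.tendsto 0
  · exact ((hc.continuousAt.div continuous_norm.continuousAt (norm_ne_zero_iff.2 hw)).neg).smul
      continuousAt_id

/-- Cauchy–Schwarz reduces the problem to the radial function `-‖w‖ r + β⁻¹ φ(r)`, minimized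
strictly where `φ' = β‖w‖`. If `v` already has the optimal radius, strictness comes from the
equality case of Cauchy–Schwarz. -/
theorem gibbs_lt {β : ℝ} (hβ : 0 < β) (w : W) {v : W} (hv : ‖v‖ ≤ 1 / 2)
    (hne : v ≠ gibbsPoint β w) :
    ⟪w, gibbsPoint β w⟫ + 1 / β * radialEntropy ‖gibbsPoint β w‖ <
      ⟪w, v⟫ + 1 / β * radialEntropy ‖v‖ := by
  rw [inner_gibbsPoint, norm_gibbsPoint hβ]
  set r := gibbsRadius (β * ‖w‖) with hr
  have hcs : -(‖w‖ * ‖v‖) ≤ ⟪w, v⟫ := neg_le_of_abs_le (abs_real_inner_le_norm w v)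
  by_cases hvr : ‖v‖ = r
  · rw [hvr] at hcs ⊢
    have hlt : -(‖w‖ * r) < ⟪w, v⟫ := by
      refine lt_of_le_of_ne hcs fun heq => hne ?_
      have h1 : ⟪-w, v⟫ = ‖-w‖ * ‖v‖ := by rw [inner_neg_left, ← heq, norm_neg, hvr, neg_neg]
      rw [inner_eq_norm_mul_iff_real, norm_neg, hvr] at h1
      rcases eq_or_ne w 0 with rfl | hw
      · rw [norm_zero, mul_zero, gibbsRadius_zero] at hr
        rw [hr, norm_eq_zero] at hvr
        simp [hvr, gibbsPoint]
      · have hw' := norm_ne_zero_iff.2 hw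
        rw [gibbsPoint, ← hr, ← smul_right_injective W hw' |>.eq_iff]
        rw [← h1, smul_smul, smul_neg, ← neg_smul]
        congr 1
        field_simp
    linarith
  · have ht := tangent_lt_radialEntropy (t := β * ‖w‖) ⟨by linarith [norm_nonneg v], hv⟩ hvr
    rw [← hr] at ht
    have h2 := mul_lt_mul_of_pos_left ht (one_div_pos.2 hβ)
    have h3 : 1 / β * (radialEntropy r + β * ‖w‖ * (‖v‖ - r)) =
        1 / β * radialEntropy r + ‖w‖ * (‖v‖ - r) := by field_simp
    rw [h3] at h2
    linarith

end InnerProductSpace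

/-- Apply `log x ≤ x - 1` at `x = exp (-T) / s` and at `x = (1 - s)⁻¹`. The parameter `T` is free so
that it can later grow with the momentum and make both terms integrable. -/
theorem abs_entropyDensity_le {s : ℝ} (h0 : 0 ≤ s) (h1 : s ≤ 1 / 2) (T : ℝ) :
    |entropyDensity s| ≤ s * (T + 2) + Real.exp (-T) := by
  have hn : 0 ≤ Real.binEntropy s := Real.binEntropy_nonneg h0 (by linarith)
  rw [entropyDensity_eq_neg_binEntropy, abs_neg, abs_of_nonneg hn, Real.binEntropy, Real.log_inv,
    Real.log_inv]
  have ha : s * -Real.log s ≤ s * T + Real.exp (-T) := by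
    rcases h0.eq_or_lt with rfl | hs
    · simp [(Real.exp_pos _).le]
    · have h := Real.log_le_sub_one_of_pos (x := Real.exp (-T) / s) (by positivity)
      rw [Real.log_div (by positivity) hs.ne', Real.log_exp] at h
      have h' := mul_le_mul_of_nonneg_left h hs.le
      have : s * (Real.exp (-T) / s - 1) = Real.exp (-T) - s := by field_simp
      linarith
  have hb : (1 - s) * -Real.log (1 - s) ≤ s * 2 := by
    have h := Real.log_le_sub_one_of_pos (x := (1 - s)⁻¹) (inv_pos.2 (by linarith))
    rw [Real.log_inv] at h
    have h' := mul_le_mul_of_nonneg_left h (by linarith : 0 ≤ 1 - s)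
    rw [mul_sub, mul_inv_cancel₀ (by linarith)] at h'
    linarith
  linarith

/-- The traceless part `(g - 1 / 2, a)` of the matrix `[[g, a], [conj a, 1 - g]]`. -/
def bcsVec (g : ℝ) (a : ℂ) : WithLp 2 (ℝ × ℂ) := WithLp.toLp 2 (g - 1 / 2, a)

theorem norm_bcsVec_sq (g : ℝ) (a : ℂ) : ‖bcsVec g a‖ ^ 2 = (g - 1 / 2) ^ 2 + ‖a‖ ^ 2 := by
  rw [WithLp.prod_norm_sq_eq_of_L2]
  simp [bcsVec]

theorem norm_bcsVec (g : ℝ) (a : ℂ) : ‖bcsVec g a‖ = √((g - 1 / 2) ^ 2 + ‖a‖ ^ 2) := by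
  rw [← norm_bcsVec_sq, Real.sqrt_sq (norm_nonneg _)]

theorem entropyDensity_bcsS (g : ℝ) (a : ℂ) :
    entropyDensity (bcsS g a) = radialEntropy ‖bcsVec g a‖ := by
  rw [norm_bcsVec, radialEntropy, bcsS]

theorem norm_bcsVec_le_iff (g : ℝ) (a : ℂ) :
    ‖bcsVec g a‖ ≤ 1 / 2 ↔ ‖a‖ ^ 2 ≤ g * (1 - g) := by
  rw [← sq_le_sq₀ (norm_nonneg _) (by norm_num), norm_bcsVec_sq]
  constructor <;> intro h <;> nlinarith

theorem bcsVec_combo (t g g' : ℝ) (a d : ℂ) :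
    bcsVec (g + t * (g' - g)) (a + t * d) =
      (1 - t) • bcsVec g a + t • bcsVec g' (a + d) := by
  refine WithLp.ofLp_injective 2 (Prod.ext ?_ ?_)
  · simp [bcsVec]; ring
  · simp [bcsVec]; ring

theorem inner_toLp_bcsVec (ξ g : ℝ) (D a : ℂ) :
    ⟪(WithLp.toLp 2 (ξ, D) : WithLp 2 (ℝ × ℂ)), bcsVec g a⟫ =
      ξ * (g - 1 / 2) + (starRingEnd ℂ D * a).re := by
  rw [WithLp.prod_inner_apply]
  simp [bcsVec, Complex.inner, mul_comm]

/-- Since `s ≤ 1/2`, one has `s / 2 ≤ s (1 - s) ≤ g (1 - g) ≤ g`. -/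
theorem bcsS_le_two_mul {g : ℝ} {a : ℂ} (h : ‖a‖ ^ 2 ≤ g * (1 - g)) :
    bcsS g a ≤ 2 * g := by
  have h1 := bcsS_spec g a
  have h2 := bcsS_mem_Icc g a h
  nlinarith [h2.1, h2.2, sq_nonneg ‖a‖, sq_nonneg g]

end

/-! ### Fourier transforms and variations with prescribed, boundedly supported `α̂`. -/

noncomputable section

section Fourier

open Filter TemperedDistribution
open scoped SchwartzMap ENNReal Topology ComplexConjugate

variable {E : Type*} [NormedAddCommGroup E] [InnerProductSpace ℝ E] [FiniteDimensional ℝ E]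
  [MeasurableSpace E] [BorelSpace E]

theorem integral_conj_mul_fourierInv {f g : E → ℂ} (hf : Integrable f) (hg : Integrable g) :
    ∫ x, conj (f x) * 𝓕⁻ g x = ∫ ξ, conj (𝓕 f ξ) * g ξ := by
  have h := VectorFourier.integral_sesq_fourierIntegral_eq_neg_flip (μ := (volume : Measure E))
    (ν := (volume : Measure E)) (L := innerₗ E) (innerSL ℂ (E := ℂ)) Real.continuous_fourierChar
    continuous_inner hf hg
  simp only [flip_innerₗ, innerSL_apply_apply, RCLike.inner_apply'] at h
  exact h.symm

theorem integral_fourierInv_mul {f g : E → ℂ} (hf : Integrable f) (hg : Integrable g) :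
    ∫ x, 𝓕⁻ f x * g x = ∫ x, f x * 𝓕⁻ g x := by
  have h := VectorFourier.integral_fourierIntegral_smul_eq_flip (μ := (volume : Measure E))
    (ν := (volume : Measure E)) (L := -innerₗ E) Real.continuous_fourierChar
    (by simp only [LinearMap.neg_apply, innerₗ_apply_apply]; exact continuous_inner.neg) hf hg
  have h2 : (-innerₗ E : E →ₗ[ℝ] E →ₗ[ℝ] ℝ).flip = -innerₗ E := by
    ext x y
    simp [real_inner_comm]
  rw [h2] at h
  exact h

theorem continuous_fourierInv_of_integrable {f : E → ℂ} (hf : Integrable f) :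
    Continuous (𝓕⁻ f : E → ℂ) :=
  VectorFourier.fourierIntegral_continuous Real.continuous_fourierChar
    (by simp only [LinearMap.neg_apply, innerₗ_apply_apply]; exact continuous_inner.neg) hf

theorem continuous_fourier_of_integrable {f : E → ℂ} (hf : Integrable f) :
    Continuous (𝓕 f : E → ℂ) :=
  VectorFourier.fourierIntegral_continuous Real.continuous_fourierChar
    (by simpa using continuous_inner) hf

theorem norm_fourierInv_le_integral_norm (f : E → ℂ) (x : E) : ‖𝓕⁻ f x‖ ≤ ∫ y, ‖f y‖ := by
  rw [Real.fourierInv_eq]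
  refine (norm_integral_le_integral_norm _).trans_eq ?_
  simp_rw [Circle.norm_smul]

/-- On `L¹ ∩ L²` the inverse Fourier transform on `L²` is given by the Fourier integral. -/
theorem coeFn_fourierInv_toLp {h : E → ℂ} (h1 : Integrable h) (h2 : MemLp h 2 volume) :
    (𝓕⁻ (h2.toLp h) : Lp (α := E) ℂ 2 volume) =ᵐ[volume] (𝓕⁻ h : E → ℂ) := by
  -- It suffices to test against smooth compactly supported functions. The transform passes to the
  -- test function by duality on the `L²` side and by Fubini on the integral side.
  refine ae_eq_of_integral_contDiff_smul_eq
    ((Lp.memLp _).locallyIntegrable one_le_two)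
    (continuous_fourierInv_of_integrable h1).locallyIntegrable fun g g_smooth g_cpt => ?_
  have hg₁ : HasCompactSupport (Complex.ofRealCLM ∘ g) := g_cpt.comp_left rfl
  have hg₂ : ContDiff ℝ ((⊤ : ℕ∞) : WithTop ℕ∞) (Complex.ofRealCLM ∘ g) := by fun_prop
  set φ : 𝓢(E, ℂ) := hg₁.toSchwartzMap hg₂ with hφ
  have hφg (x : E) : φ x = g x := by simp [hφ]
  have key : (Lp.toTemperedDistribution (𝓕⁻ (h2.toLp h) : Lp (α := E) ℂ 2 volume)) φ =
      (Lp.toTemperedDistribution (h2.toLp h)) (𝓕⁻ φ) := by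
    rw [← Lp.fourierInv_toTemperedDistribution_eq]
    simp
  rw [Lp.toTemperedDistribution_apply, Lp.toTemperedDistribution_apply] at key
  simp only [hφg, smul_eq_mul, SchwartzMap.fourierInv_coe] at key
  simp only [Complex.real_smul]
  rw [key]
  calc _ = ∫ x, 𝓕⁻ (φ : E → ℂ) x * h x := by
        refine integral_congr_ae ?_
        filter_upwards [h2.coeFn_toLp] with x hx
        rw [hx]
    _ = ∫ x, φ x * 𝓕⁻ h x := integral_fourierInv_mul φ.integrable h1
    _ = _ := by simp only [hφg]

/-- On the support of `h` the Sobolev weight is at most `(1 + R ^ 2) ^ (s / 2)`, so the weighted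
function stays in `L²`. -/
theorem memSobolev_fourierInv_toLp {h : E → ℂ} (h2 : MemLp h 2 volume) {R : ℝ}
    (hR : ∀ x, R < ‖x‖ → h x = 0) (s : ℝ) (hs : 0 ≤ s) :
    MemSobolev s 2
      (Lp.toTemperedDistribution (𝓕⁻ (h2.toLp h) : Lp (α := E) ℂ 2 volume)) := by
  rw [memSobolev_iff_exists_smulLeftCLM_fourier, Lp.fourier_toTemperedDistribution_eq,
    fourier_fourierInv_eq]
  have hb : (fun x : E => (((1 + ‖x‖ ^ 2) ^ (-(s / 2)) : ℝ) : ℂ)).HasTemperateGrowth := by fun_prop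
  have hbm : MemLp (fun x : E => (((1 + ‖x‖ ^ 2) ^ (-(s / 2)) : ℝ) : ℂ)) ∞ volume := by
    refine memLp_top_of_bound hb.1.continuous.aestronglyMeasurable 1 (Eventually.of_forall ?_)
    intro x
    rw [Complex.norm_real, Real.norm_eq_abs, abs_of_nonneg (by positivity)]
    exact Real.rpow_le_one_of_one_le_of_nonpos (by simp) (by linarith)
  have hw : MemLp (fun x : E => (((1 + ‖x‖ ^ 2) ^ (s / 2) : ℝ) : ℂ) * h x) 2 volume := by
    refine MemLp.of_le_mul (c := (1 + R ^ 2) ^ (s / 2)) h2 ?_ (Eventually.of_forall fun x => ?_)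
    · refine AEStronglyMeasurable.mul ?_ h2.1
      have hc : (fun x : E => (((1 + ‖x‖ ^ 2) ^ (s / 2) : ℝ) : ℂ)).HasTemperateGrowth := by fun_prop
      exact hc.1.continuous.aestronglyMeasurable
    · by_cases hx : R < ‖x‖
      · simp [hR x hx]
      · rw [norm_mul, Complex.norm_real, Real.norm_eq_abs, abs_of_nonneg (by positivity)]
        gcongr
        exact not_lt.1 hx
  refine ⟨hw.toLp _, ?_⟩
  have heq : h2.toLp h = (hbm.toLp _ • hw.toLp _ : Lp (α := E) ℂ 2 volume) := by
    refine Lp.ext ?_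
    filter_upwards [h2.coeFn_toLp, Lp.coeFn_lpSMul (r := 2) (hbm.toLp _) (hw.toLp _),
      hbm.coeFn_toLp, hw.coeFn_toLp] with x ha hb hc hd
    rw [ha, hb, Pi.smul_apply', hc, hd, smul_eq_mul, ← mul_assoc, ← Complex.ofReal_mul,
      ← Real.rpow_add (by positivity)]
    simp
  rw [heq, Lp.toTemperedDistribution_smul_eq hb, smulLeftCLM_smulLeftCLM_apply hb (by fun_prop)]
  convert! smulLeftCLM_const 1 _ using 2
  · congr 1
    ext x
    rw [Pi.mul_apply, ← Complex.ofReal_mul, ← Real.rpow_add (by positivity)]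
    simp
  · rw [one_smul]

theorem ae_comp_smul {c : ℝ} (hc : c ≠ 0) {P : E → Prop} (hP : ∀ᵐ x ∂(volume : Measure E), P x) :
    ∀ᵐ x ∂(volume : Measure E), P (c • x) := by
  have h : Measure.map (fun x : E => c • x) volume ≪ volume := by
    rw [Measure.map_addHaar_smul _ hc]
    exact Measure.smul_absolutelyContinuous
  exact ae_of_ae_map (measurable_const_smul c).aemeasurable (h.ae_le hP)

end Fourier

section FourierHat

open Filter TemperedDistribution
open scoped SchwartzMap ENNReal Topology ComplexConjugate

theorem fourierHat_add_smul (α η : L2C) (t : ℂ) :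
    fourierHat (α + t • η) =ᵐ[volume] fun p => fourierHat α p + t * fourierHat η p := by
  have h : (𝓕 (α + t • η) : L2C) =ᵐ[volume] fun p => (𝓕 α : L2C) p + t * (𝓕 η : L2C) p := by
    rw [FourierTransform.fourier_add, FourierTransform.fourier_smul]
    filter_upwards [Lp.coeFn_add (𝓕 α : L2C) (t • 𝓕 η), Lp.coeFn_smul t (𝓕 η : L2C)] with p h1 h2
    rw [h1, Pi.add_apply, h2, Pi.smul_apply, smul_eq_mul]
  filter_upwards [ae_comp_smul (inv_ne_zero Real.two_pi_pos.ne') h] with p hp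
  simp only [fourierHat]
  rw [hp]
  ring

theorem aestronglyMeasurable_fourierHat (α : L2C) :
    AEStronglyMeasurable (fourierHat α) volume := by
  refine AEStronglyMeasurable.const_mul ?_ _
  have h : Measure.map (fun x : E3 => (2 * Real.pi)⁻¹ • x) volume ≪ volume := by
    rw [Measure.map_addHaar_smul _ (inv_ne_zero Real.two_pi_pos.ne')]
    exact Measure.smul_absolutelyContinuous
  exact ((Lp.memLp (𝓕 α : L2C)).1.mono_ac h).comp_measurable (measurable_const_smul _)

/-- This supplies the admissible directions `η`. Bounded support of `d` makes `η` both `H¹` and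
bounded, so the Parseval identity holds against every `f ∈ L¹`. This generality is needed because it
is applied to `f = Vα`, which is only known to be integrable. -/
theorem exists_fourierHat_eq {d : E3 → ℂ} (hd : AEStronglyMeasurable d volume) {C R : ℝ}
    (hC : ∀ᵐ p, ‖d p‖ ≤ C) (hR : ∀ p, R < ‖p‖ → d p = 0) :
    ∃ η : L2C, fourierHat η =ᵐ[volume] d ∧ MemSobolev 1 2 (Lp.toTemperedDistribution η) ∧
      MemLp η ∞ volume ∧ ∀ f : E3 → ℂ, Integrable f →
        ∫ x, conj (f x) * η x = (((2 * Real.pi) ^ (-(3 / 2) : ℝ) : ℝ) : ℂ) *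
          ∫ p, conj (𝓕 f ((2 * Real.pi)⁻¹ • p)) * d p := by
  have hpi := Real.two_pi_pos
  set c : ℝ := (2 * Real.pi) ^ (-(3 / 2) : ℝ) with hc
  have hc0 : (c : ℂ) ≠ 0 := Complex.ofReal_ne_zero.2 (by positivity)
  -- The dilation and the constant undo those in `fourierHat`.
  let h : E3 → ℂ := fun ξ => (c : ℂ)⁻¹ * d ((2 * Real.pi) • ξ)
  have hhm : AEStronglyMeasurable h volume := by
    refine AEStronglyMeasurable.const_mul ?_ _
    have hac : Measure.map (fun x : E3 => (2 * Real.pi) • x) volume ≪ volume := by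
      rw [Measure.map_addHaar_smul _ hpi.ne']
      exact Measure.smul_absolutelyContinuous
    exact (hd.mono_ac hac).comp_measurable (measurable_const_smul _)
  have hhR : ∀ ξ, R / (2 * Real.pi) < ‖ξ‖ → h ξ = 0 := fun ξ hξ => by
    simp only [h]
    rw [hR, mul_zero]
    rw [norm_smul, Real.norm_of_nonneg hpi.le]
    rwa [div_lt_iff₀' hpi] at hξ
  have hhB : ∀ᵐ ξ, ‖h ξ‖ ≤ c⁻¹ * C := by
    filter_upwards [ae_comp_smul hpi.ne' hC] with ξ hξ
    rw [norm_mul, norm_inv, Complex.norm_real, Real.norm_of_nonneg (by positivity)]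
    gcongr
  have hmem (q : ℝ≥0∞) : MemLp h q volume := by
    have h1 : MemLp h ∞ (volume.restrict (Metric.closedBall 0 (R / (2 * Real.pi)))) :=
      memLp_top_of_bound hhm.restrict _ (ae_restrict_of_ae hhB)
    have : IsFiniteMeasure ((volume : Measure E3).restrict
        (Metric.closedBall 0 (R / (2 * Real.pi)))) :=
      ⟨by rw [Measure.restrict_apply_univ]; exact measure_closedBall_lt_top⟩
    have h2 := (h1.mono_exponent (le_top : q ≤ ∞))
    have h3 := (memLp_indicator_iff_restrict Metric.isClosed_closedBall.measurableSet).2 h2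
    rwa [Set.indicator_eq_self.2] at h3
    intro ξ hξ
    by_contra hn
    exact hξ (hhR ξ (by simpa using hn))
  have hint : Integrable h := memLp_one_iff_integrable.1 (hmem 1)
  have hinv := coeFn_fourierInv_toLp hint (hmem 2)
  refine ⟨𝓕⁻ ((hmem 2).toLp h), ?_, memSobolev_fourierInv_toLp (hmem 2) hhR 1 zero_le_one, ?_,
    fun f hf => ?_⟩
  · filter_upwards [ae_comp_smul (inv_ne_zero hpi.ne') (hmem 2).coeFn_toLp] with p hp
    rw [fourierHat, fourier_fourierInv_eq, hp]
    simp only [h]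
    rw [smul_inv_smul₀ hpi.ne', ← hc, mul_inv_cancel_left₀ hc0]
  · exact memLp_top_of_bound (Lp.memLp _).1 (∫ y, ‖h y‖) (by
      filter_upwards [hinv] with x hx
      rw [hx]
      exact norm_fourierInv_le_integral_norm h x)
  · calc _ = ∫ x, conj (f x) * 𝓕⁻ h x := by
          refine integral_congr_ae ?_
          filter_upwards [hinv] with x hx
          rw [hx]
      _ = ∫ ξ, conj (𝓕 f ξ) * h ξ := integral_conj_mul_fourierInv hf hint
      _ = (c : ℂ)⁻¹ * ∫ ξ : E3, conj (𝓕 f ((2 * Real.pi)⁻¹ • ((2 * Real.pi) • ξ))) *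
            d ((2 * Real.pi) • ξ) := by
          rw [← integral_const_mul]
          refine integral_congr_ae (Eventually.of_forall fun ξ => ?_)
          simp only [h]
          rw [inv_smul_smul₀ hpi.ne']
          ring
      _ = _ := by
          rw [Measure.integral_comp_smul volume
            (fun p => conj (𝓕 f ((2 * Real.pi)⁻¹ • p)) * d p) (2 * Real.pi), Complex.real_smul,
            ← mul_assoc]
          congr 1
          rw [← Complex.ofReal_inv, ← Complex.ofReal_mul]
          congr 1
          -- The Jacobian `(2π)⁻³` times `c⁻¹ = (2π)^(3/2)` is again `c`.
          rw [finrank_euclideanSpace_fin, abs_of_pos (by positivity), hc, ← Real.rpow_neg hpi.le,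
            ← Real.rpow_natCast, ← Real.rpow_neg hpi.le, ← Real.rpow_add hpi]
          norm_num

end FourierHat
end

/-! ### Integrability of the terms of the functional and the shape of its domain. -/

noncomputable section

open Filter TemperedDistribution
open scoped SchwartzMap ENNReal Topology ComplexConjugate RealInnerProductSpace

/-- Pointwise, `x³ ≤ x² + x⁶` for `x ≥ 0`. -/
theorem MeasureTheory.MemLp.three_of_two_of_six {X : Type*} [MeasurableSpace X] {ν : Measure X}
    {f : X → ℂ} (h2 : MemLp f 2 ν) (h6 : MemLp f 6 ν) : MemLp f 3 ν := by
  rw [← integrable_norm_rpow_iff h2.1 (by norm_num) (by norm_num)]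
  have i2 := (integrable_norm_rpow_iff h2.1 (by norm_num) (by norm_num)).2 h2
  have i6 := (integrable_norm_rpow_iff h2.1 (by norm_num) (by norm_num)).2 h6
  refine (i2.add i6).mono' ?_ (Eventually.of_forall fun x => ?_)
  · exact (h2.1.norm.aemeasurable.pow_const _).aestronglyMeasurable
  · simp only [ENNReal.toReal_ofNat, Pi.add_apply]
    norm_cast
    rw [norm_pow, norm_norm]
    nlinarith [sq_nonneg (‖f x‖ ^ 3 - ‖f x‖), mul_nonneg (sq_nonneg ‖f x‖) (sq_nonneg (‖f x‖ - 1)),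
      pow_nonneg (norm_nonneg (f x)) 3, sq_nonneg (‖f x‖ ^ 3 - 1 / 2), sq_nonneg ‖f x‖,
      mul_nonneg (sq_nonneg ‖f x‖) (sq_nonneg (‖f x‖ ^ 2 - ‖f x‖ / 2))]

theorem holderTriple_three_halves : ENNReal.HolderTriple (3 / 2) 3 1 := ⟨by
  rw [ENNReal.inv_div (by simp) (by simp), inv_one, div_eq_mul_inv, ← add_one_mul,
    two_add_one_eq_three, ENNReal.mul_inv_cancel (by simp) (by simp)]⟩

section Potential

variable {V : E3 → ℝ} {α : L2C}

theorem memLp_six_of_memSobolev (hα : MemSobolev 1 2 (Lp.toTemperedDistribution α)) :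
    MemLp α 6 volume := by
  have h := hα.memLp (p := 6) (by rw [finrank_euclideanSpace_fin]; norm_num)
  simpa using h

/-- `L³` is dual to `L^(3/2)`. This integrability is what makes the gap function continuous. -/
theorem integrable_potential_mul (hV : MemLp V (3 / 2) (volume : Measure E3))
    (hα : MemSobolev 1 2 (Lp.toTemperedDistribution α)) :
    Integrable (fun x => (V x : ℂ) * α x) volume := by
  have h3 := (Lp.memLp α).three_of_two_of_six (memLp_six_of_memSobolev hα)
  have : ENNReal.HolderTriple (3 / 2) 3 1 := holderTriple_three_halves
  rw [← memLp_one_iff_integrable]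
  exact h3.mul' (hV.ofReal (K := ℂ))

theorem integrable_norm_sq_mul_potential (hV : MemLp V (3 / 2) (volume : Measure E3))
    (hα : MemSobolev 1 2 (Lp.toTemperedDistribution α)) :
    Integrable (fun x => ‖α x‖ ^ 2 * V x) volume := by
  have h6 := (memLp_six_of_memSobolev hα).norm
  have : ENNReal.HolderTriple (3 / 2) 3 1 := holderTriple_three_halves
  have : ENNReal.HolderTriple 6 6 3 := ⟨by
    rw [← ENNReal.toReal_eq_toReal_iff' (by simp) (by simp),
      ENNReal.toReal_add (by simp) (by simp)]
    norm_num⟩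
  have h3 : MemLp (fun x => ‖α x‖ * ‖α x‖) 3 volume := h6.mul' h6
  have h := h3.mul' hV (r := 1)
  rw [memLp_one_iff_integrable] at h
  refine h.congr (Eventually.of_forall fun x => ?_)
  simp only
  ring

end Potential

theorem mem_Icc_of_norm_bcsVec_le {g : ℝ} {a : ℂ} (h : ‖bcsVec g a‖ ≤ 1 / 2) :
    0 ≤ g ∧ g ≤ 1 := by
  rw [norm_bcsVec_le_iff] at h
  constructor <;> nlinarith [sq_nonneg ‖a‖]

theorem aestronglyMeasurable_of_integrable_weight {γ : E3 → ℝ}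
    (h : Integrable (fun p : E3 => (1 + ‖p‖ ^ 2) * γ p) volume) :
    AEStronglyMeasurable γ volume := by
  have hc : Continuous fun p : E3 => (1 + ‖p‖ ^ 2)⁻¹ :=
    Continuous.inv₀ (by fun_prop) fun p => (by positivity : (1 : ℝ) + ‖p‖ ^ 2 ≠ 0)
  refine (hc.aestronglyMeasurable.mul h.1).congr (Eventually.of_forall fun p => ?_)
  exact inv_mul_cancel_left₀ (by positivity : (1 : ℝ) + ‖p‖ ^ 2 ≠ 0) _

theorem integrable_kinetic {γ : E3 → ℝ}
    (h : Integrable (fun p : E3 => (1 + ‖p‖ ^ 2) * γ p) volume) (μ : ℝ) :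
    Integrable (fun p : E3 => (‖p‖ ^ 2 - μ) * γ p) volume := by
  refine (h.const_mul (1 + |μ|)).mono ?_ (Eventually.of_forall fun p => ?_)
  · exact (by fun_prop : Continuous fun p : E3 => ‖p‖ ^ 2 - μ).aestronglyMeasurable.mul
      (aestronglyMeasurable_of_integrable_weight h)
  · rw [← mul_assoc, norm_mul, norm_mul]
    gcongr
    rw [Real.norm_eq_abs, Real.norm_of_nonneg (by positivity)]
    refine (abs_sub _ _).trans ?_
    rw [abs_of_nonneg (by positivity)]
    nlinarith [abs_nonneg μ, sq_nonneg ‖p‖, mul_nonneg (abs_nonneg μ) (sq_nonneg ‖p‖)]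

theorem aestronglyMeasurable_bcsVec {γ : E3 → ℝ} {a : E3 → ℂ} (hγ : AEStronglyMeasurable γ volume)
    (ha : AEStronglyMeasurable a volume) :
    AEStronglyMeasurable (fun p => bcsVec (γ p) (a p)) volume := by
  have hc : Continuous fun x : ℝ × ℂ => bcsVec x.1 x.2 := by
    refine (WithLp.prod_continuous_toLp 2 ℝ ℂ).comp ?_
    fun_prop
  exact hc.comp_aestronglyMeasurable (hγ.prodMk ha)

/-- Take `T = ‖p‖²` in `abs_entropyDensity_le` and use `s ≤ 2γ`: the density is dominated by `4 (1 +
p²) γ + exp (-p²)`. -/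
theorem integrable_radialEntropy {γ : E3 → ℝ} {a : E3 → ℂ}
    (h : Integrable (fun p : E3 => (1 + ‖p‖ ^ 2) * γ p) volume)
    (ha : AEStronglyMeasurable a volume) (hv : ∀ᵐ p, ‖bcsVec (γ p) (a p)‖ ≤ 1 / 2) :
    Integrable (fun p => radialEntropy ‖bcsVec (γ p) (a p)‖) volume := by
  have hg : Integrable (fun p : E3 => Real.exp (-‖p‖ ^ 2)) volume := by
    have := (GaussianFourier.integrable_cexp_neg_mul_sq_norm_add (V := E3) (b := 1)
      (by simp) 0 0).norm
    refine this.congr (Eventually.of_forall fun p => ?_)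
    simp [Complex.norm_exp, ← Complex.ofReal_pow]
  refine ((h.const_mul 4).add hg).mono' ?_ ?_
  · exact continuous_radialEntropy.comp_aestronglyMeasurable
      (aestronglyMeasurable_bcsVec (aestronglyMeasurable_of_integrable_weight h) ha).norm
  · filter_upwards [hv] with p hp
    have hp' := (norm_bcsVec_le_iff _ _).1 hp
    have hm := bcsS_mem_Icc _ _ hp'
    rw [← entropyDensity_bcsS, Real.norm_eq_abs]
    refine (abs_entropyDensity_le hm.1 hm.2 (‖p‖ ^ 2)).trans ?_
    rw [Pi.add_apply]
    refine add_le_add_left ?_ _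
    have h2 := bcsS_le_two_mul hp'
    have h0 := (mem_Icc_of_norm_bcsVec_le hp).1
    calc _ ≤ 2 * γ p * (‖p‖ ^ 2 + 2) := by gcongr
      _ ≤ _ := by nlinarith [sq_nonneg ‖p‖, mul_nonneg h0 (sq_nonneg ‖p‖)]

/-- The bound `|α̂|² ≤ γ (1 - γ)` already forces `0 ≤ γ ≤ 1`, so a single ball condition remains,
which makes the domain visibly convex. -/
theorem mem_bcsDomain_iff {γ : E3 → ℝ} {α : L2C} : (γ, α) ∈ bcsDomain ↔
    Integrable (fun p : E3 => (1 + ‖p‖ ^ 2) * γ p) volume ∧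
    MemSobolev 1 2 (Lp.toTemperedDistribution α) ∧
    ∀ᵐ p, ‖bcsVec (γ p) (fourierHat α p)‖ ≤ 1 / 2 := by
  simp only [norm_bcsVec_le_iff]
  constructor
  · rintro ⟨h1, -, h3, h4⟩
    exact ⟨h1, h3, h4⟩
  · rintro ⟨h1, h3, h4⟩
    refine ⟨h1, ?_, h3, h4⟩
    filter_upwards [h4] with p hp
    exact mem_Icc_of_norm_bcsVec_le ((norm_bcsVec_le_iff _ _).2 hp)

theorem bcsFunctional_eq (V : E3 → ℝ) (μ β : ℝ) (γ : E3 → ℝ) (α : L2C) :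
    bcsFunctional V μ β γ α = (∫ p : E3, (‖p‖ ^ 2 - μ) * γ p) + (∫ x : E3, ‖α x‖ ^ 2 * V x) +
      1 / β * ∫ p, radialEntropy ‖bcsVec (γ p) (fourierHat α p)‖ := by
  simp only [bcsFunctional, bcsEntropy, entropyDensity_bcsS]
  ring

theorem integrable_mul_of_bounded_support {𝕜 : Type*} [RCLike 𝕜] {k e : E3 → 𝕜}
    (hk : Continuous k) (he : AEStronglyMeasurable e volume) {C R : ℝ} (hC : ∀ᵐ p, ‖e p‖ ≤ C)
    (hR : ∀ p, R < ‖p‖ → e p = 0) : Integrable (fun p => k p * e p) volume := by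
  obtain ⟨K, hK⟩ := (isCompact_closedBall (0 : E3) R).exists_bound_of_continuousOn hk.continuousOn
  have hi : Integrable ((Metric.closedBall (0 : E3) R).indicator fun _ => K * C) volume :=
    (integrable_indicator_iff Metric.isClosed_closedBall.measurableSet).2
      (integrableOn_const measure_closedBall_lt_top.ne)
  refine hi.mono' (hk.aestronglyMeasurable.mul he) ?_
  filter_upwards [hC] with p hp
  by_cases hpR : R < ‖p‖
  · rw [hR p hpR, mul_zero, norm_zero, Set.indicator_of_notMem (by simpa using hpR)]
  · have hpB : p ∈ Metric.closedBall (0 : E3) R := by simpa using hpR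
    rw [Set.indicator_of_mem hpB, norm_mul]
    have := hK p hpB
    gcongr
    exact (norm_nonneg _).trans this
end

/-! ### The first variation. -/

noncomputable section

open Filter TemperedDistribution
open scoped SchwartzMap ENNReal Topology ComplexConjugate RealInnerProductSpace

theorem norm_bcsVec_combo_le {g e : ℝ} {a d : ℂ} (h0 : ‖bcsVec g a‖ ≤ 1 / 2)
    (h1 : ‖bcsVec (g + e) (a + d)‖ ≤ 1 / 2) {t : ℝ} (ht : t ∈ Set.Icc (0 : ℝ) 1) :
    ‖bcsVec (g + t * e) (a + t * d)‖ ≤ 1 / 2 ∧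
      radialEntropy ‖bcsVec (g + t * e) (a + t * d)‖ ≤ (1 - t) * radialEntropy ‖bcsVec g a‖ +
        t * radialEntropy ‖bcsVec (g + e) (a + d)‖ := by
  have h := bcsVec_combo t g (g + e) a d
  rw [add_sub_cancel_left] at h
  rw [h]
  have hc := convexOn_radialEntropy_norm (W := WithLp 2 (ℝ × ℂ))
  have ht' : 0 ≤ 1 - t := by linarith [ht.2]
  have m0 := mem_closedBall_zero_iff.2 h0
  have m1 := mem_closedBall_zero_iff.2 h1
  exact ⟨mem_closedBall_zero_iff.1 (hc.1 m0 m1 ht' ht.1 (by ring)), hc.2 m0 m1 ht' ht.1 (by ring)⟩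

/-- The first variation of the BCS functional, with the entropy term kept in convex form. -/
theorem linearized_bcsFunctional_nonneg {V : E3 → ℝ}
    (hV : MemLp V (3 / 2) (volume : Measure E3)) {μ β : ℝ} (hβ : 0 < β) {γ : E3 → ℝ} {α : L2C}
    (hmem : (γ, α) ∈ bcsDomain)
    (hmin : ∀ y ∈ bcsDomain, bcsFunctional V μ β γ α ≤ bcsFunctional V μ β y.1 y.2)
    {e : E3 → ℝ} (he : Integrable (fun p : E3 => (1 + ‖p‖ ^ 2) * e p) volume) {η : L2C}
    (hη : MemSobolev 1 2 (Lp.toTemperedDistribution η)) (hη' : MemLp η ∞ volume)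
    (hv : ∀ᵐ p, ‖bcsVec (γ p + e p) (fourierHat α p + fourierHat η p)‖ ≤ 1 / 2) :
    0 ≤ (∫ p : E3, (‖p‖ ^ 2 - μ) * e p) + 2 * (∫ x, conj ((V x : ℂ) * α x) * η x).re +
      1 / β * ((∫ p, radialEntropy ‖bcsVec (γ p + e p) (fourierHat α p + fourierHat η p)‖) -
        ∫ p, radialEntropy ‖bcsVec (γ p) (fourierHat α p)‖) := by
  obtain ⟨hγ, hα, hv0⟩ := mem_bcsDomain_iff.1 hmem
  have hγe : Integrable (fun p : E3 => (1 + ‖p‖ ^ 2) * (γ p + e p)) volume := by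
    simpa only [mul_add] using! hγ.add he
  have hS0 := integrable_radialEntropy hγ (aestronglyMeasurable_fourierHat α) hv0
  have hS1 : Integrable (fun p => radialEntropy
      ‖bcsVec (γ p + e p) (fourierHat α p + fourierHat η p)‖) volume := integrable_radialEntropy hγe
    ((aestronglyMeasurable_fourierHat α).add (aestronglyMeasurable_fourierHat η)) hv
  have hVα := integrable_norm_sq_mul_potential hV hα
  have hVη := integrable_norm_sq_mul_potential hV hη
  -- The cross term is finite because `Vα ∈ L¹` and `η ∈ L^∞`.
  have hX : Integrable (fun x => conj ((V x : ℂ) * α x) * η x) volume := by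
    have hf : Integrable (fun x => conj ((V x : ℂ) * α x)) volume :=
      Complex.conjCLE.toContinuousLinearMap.integrable_comp (integrable_potential_mul hV hα)
    exact memLp_one_iff_integrable.1 (hη'.mul' (memLp_one_iff_integrable.2 hf))
  set A := ∫ p : E3, (‖p‖ ^ 2 - μ) * e p
  set X := ∫ x, conj ((V x : ℂ) * α x) * η x
  set S0 := ∫ p, radialEntropy ‖bcsVec (γ p) (fourierHat α p)‖ with hS0def
  set S1 := ∫ p, radialEntropy ‖bcsVec (γ p + e p) (fourierHat α p + fourierHat η p)‖ with hS1def
  set Q := ∫ x, ‖η x‖ ^ 2 * V x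
  -- This is the minimality inequality at parameter `t`, divided by `t`: the kinetic term is affine
  -- in `t`, the potential term exactly quadratic, and the entropy is bounded by its chord. Letting
  -- `t → 0⁺` removes `Q`.
  have key (t : ℝ) (ht : t ∈ Set.Ioc (0 : ℝ) 1) :
      0 ≤ (A + 2 * X.re + 1 / β * (S1 - S0)) + t * Q := by
    have htI : t ∈ Set.Icc (0 : ℝ) 1 := ⟨ht.1.le, ht.2⟩
    have hhat := fourierHat_add_smul α η t
    have hγt : Integrable (fun p : E3 => (1 + ‖p‖ ^ 2) * (γ p + t * e p)) volume := by
      refine (hγ.add (he.const_mul t)).congr (Eventually.of_forall fun p => ?_)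
      simp only [Pi.add_apply]
      ring
    have hvt : ∀ᵐ p, ‖bcsVec (γ p + t * e p) (fourierHat (α + (t : ℂ) • η) p)‖ ≤ 1 / 2 := by
      filter_upwards [hhat, hv0, hv] with p hp h0 h1
      rw [hp]
      exact (norm_bcsVec_combo_le h0 h1 htI).1
    have hαt : MemSobolev 1 2 (Lp.toTemperedDistribution (α + (t : ℂ) • η)) := by
      rw [← Lp.toTemperedDistributionCLM_apply, map_add, map_smul]
      exact hα.add (hη.smul _)
    have hdom : ((fun p => γ p + t * e p), α + (t : ℂ) • η) ∈ bcsDomain :=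
      mem_bcsDomain_iff.2 ⟨hγt, hαt, hvt⟩
    have hm := hmin _ hdom
    simp only [bcsFunctional_eq] at hm
    have hkin : ∫ p : E3, (‖p‖ ^ 2 - μ) * (γ p + t * e p) =
        (∫ p : E3, (‖p‖ ^ 2 - μ) * γ p) + t * A := by
      rw [← integral_const_mul, ← integral_add (integrable_kinetic hγ μ)
        ((integrable_kinetic he μ).const_mul t)]
      congr 1
      ext p
      ring
    have hpot : ∫ x : E3, ‖(α + (t : ℂ) • η : L2C) x‖ ^ 2 * V x =
        (∫ x : E3, ‖α x‖ ^ 2 * V x) + 2 * t * X.re + t ^ 2 * Q := by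
      have hre : X.re = ∫ x, (conj ((V x : ℂ) * α x) * η x).re := by
        exact (integral_re hX).symm
      have hXre : Integrable (fun x => (conj ((V x : ℂ) * α x) * η x).re) volume := hX.re
      have hsum : Integrable (fun x => ‖α x‖ ^ 2 * V x +
          2 * t * (conj ((V x : ℂ) * α x) * η x).re) volume := hVα.add (hXre.const_mul _)
      rw [hre, ← integral_const_mul, ← integral_const_mul, ← integral_add hVα (hXre.const_mul _),
        ← integral_add hsum (hVη.const_mul _)]
      refine integral_congr_ae ?_
      filter_upwards [Lp.coeFn_add α ((t : ℂ) • η), Lp.coeFn_smul (t : ℂ) η] with x h1 h2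
      rw [h1, Pi.add_apply, h2, Pi.smul_apply, Complex.sq_norm, Complex.sq_norm, Complex.sq_norm]
      simp [Complex.normSq_apply]
      ring
    have hent : ∫ p, radialEntropy ‖bcsVec (γ p + t * e p) (fourierHat (α + (t : ℂ) • η) p)‖ ≤
        (1 - t) * S0 + t * S1 := by
      rw [hS0def, hS1def, ← integral_const_mul, ← integral_const_mul,
        ← integral_add (hS0.const_mul _) (hS1.const_mul _)]
      refine integral_mono_ae
        (integrable_radialEntropy hγt (aestronglyMeasurable_fourierHat _) hvt)
        ((hS0.const_mul _).add (hS1.const_mul _)) ?_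
      filter_upwards [hhat, hv0, hv] with p hp h0 h1
      rw [hp]
      exact (norm_bcsVec_combo_le h0 h1 htI).2
    rw [hkin, hpot] at hm
    have hent' := mul_le_mul_of_nonneg_left hent (one_div_pos.2 hβ).le
    have hfin : 0 ≤ t * ((A + 2 * X.re + 1 / β * (S1 - S0)) + t * Q) := by
      rw [← hS0def] at hm
      nlinarith
    exact nonneg_of_mul_nonneg_right hfin ht.1
  have hlim : Tendsto (fun t : ℝ => (A + 2 * X.re + 1 / β * (S1 - S0)) + t * Q) (𝓝[>] 0)
      (𝓝 (A + 2 * X.re + 1 / β * (S1 - S0))) := by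
    have hc : Continuous fun t : ℝ => (A + 2 * X.re + 1 / β * (S1 - S0)) + t * Q := by fun_prop
    have := (hc.tendsto 0).mono_left (nhdsWithin_le_nhds (s := Set.Ioi (0 : ℝ)))
    simpa using this
  exact ge_of_tendsto hlim (by
    filter_upwards [Ioc_mem_nhdsGT (zero_lt_one (α := ℝ))] with t ht using key t ht)
end

/-! ### The Euler–Lagrange equation and continuity. -/

noncomputable section

open Filter TemperedDistribution
open scoped SchwartzMap ENNReal Topology ComplexConjugate RealInnerProductSpace

/-- The gap function `Δ = 2 (Vα)^`. -/
def gapFunction (V : E3 → ℝ) (α : L2C) (p : E3) : ℂ :=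
  (2 * (2 * Real.pi) ^ (-(3 / 2) : ℝ) : ℝ) *
    𝓕 (fun x => (V x : ℂ) * α x) ((2 * Real.pi)⁻¹ • p)

theorem continuous_gapFunction {V : E3 → ℝ} {α : L2C}
    (h : Integrable (fun x => (V x : ℂ) * α x) volume) : Continuous (gapFunction V α) :=
  continuous_const.mul ((continuous_fourier_of_integrable h).comp (continuous_const_smul _))

/-- The linearized Hamiltonian `(p² - μ, Δ)`. -/
def bcsHamiltonian (V : E3 → ℝ) (μ : ℝ) (α : L2C) (p : E3) : WithLp 2 (ℝ × ℂ) :=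
  WithLp.toLp 2 (‖p‖ ^ 2 - μ, gapFunction V α p)

theorem continuous_bcsHamiltonian {V : E3 → ℝ} {α : L2C}
    (h : Integrable (fun x => (V x : ℂ) * α x) volume) (μ : ℝ) :
    Continuous (bcsHamiltonian V μ α) := by
  refine (WithLp.prod_continuous_toLp 2 ℝ ℂ).comp (Continuous.prodMk ?_ (continuous_gapFunction h))
  fun_prop

theorem abs_fst_le_norm (v : WithLp 2 (ℝ × ℂ)) : |v.fst| ≤ ‖v‖ := by
  refine abs_le_of_sq_le_sq ?_ (norm_nonneg _)
  rw [WithLp.prod_norm_sq_eq_of_L2, Real.norm_eq_abs, sq_abs]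
  exact le_add_of_nonneg_right (sq_nonneg _)

theorem norm_snd_le_norm (v : WithLp 2 (ℝ × ℂ)) : ‖v.snd‖ ≤ ‖v‖ := by
  refine (sq_le_sq₀ (norm_nonneg _) (norm_nonneg _)).1 ?_
  rw [WithLp.prod_norm_sq_eq_of_L2]
  exact le_add_of_nonneg_left (sq_nonneg _)

theorem bcsVec_fst_snd (v : WithLp 2 (ℝ × ℂ)) : bcsVec (v.fst + 1 / 2) v.snd = v := by
  rw [bcsVec, add_sub_cancel_right]
  rfl

/-- The Euler-Lagrange equation `Γ = (1 + exp (β H))⁻¹` on bounded sets of momenta. -/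
theorem ae_eq_gibbsPoint_of_norm_le {V : E3 → ℝ}
    (hV : MemLp V (3 / 2) (volume : Measure E3)) {μ β : ℝ} (hβ : 0 < β) {γ : E3 → ℝ} {α : L2C}
    (hmem : (γ, α) ∈ bcsDomain)
    (hmin : ∀ y ∈ bcsDomain, bcsFunctional V μ β γ α ≤ bcsFunctional V μ β y.1 y.2) (R : ℝ) :
    ∀ᵐ p, ‖p‖ ≤ R →
      bcsVec (γ p) (fourierHat α p) = gibbsPoint β (bcsHamiltonian V μ α p) := by
  classical
  obtain ⟨hγ, hα, hv0⟩ := mem_bcsDomain_iff.1 hmem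
  have hγm := aestronglyMeasurable_of_integrable_weight hγ
  have hαm := aestronglyMeasurable_fourierHat α
  have hVα := integrable_potential_mul hV hα
  set w := bcsHamiltonian V μ α with hw
  set v₀ : E3 → WithLp 2 (ℝ × ℂ) := fun p => gibbsPoint β (w p) with hv₀
  have hv₀c : Continuous v₀ := (continuous_gibbsPoint hβ).comp (continuous_bcsHamiltonian hVα μ)
  have hv₀n (p) : ‖v₀ p‖ ≤ 1 / 2 := norm_gibbsPoint_le hβ _
  set B := Metric.closedBall (0 : E3) R
  have hB : MeasurableSet B := Metric.isClosed_closedBall.measurableSet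
  have hBR (p : E3) (hp : R < ‖p‖) : p ∉ B := by simpa [B] using hp
  -- The competitor equals the pointwise minimizer `v₀` on `B` and the given state elsewhere.
  -- Cutting off to `B` keeps the variation bounded with bounded support, as `exists_fourierHat_eq`
  -- requires.
  set e : E3 → ℝ := B.indicator fun p => (v₀ p).fst + 1 / 2 - γ p with he
  set d : E3 → ℂ := B.indicator fun p => (v₀ p).snd - fourierHat α p with hd
  have hem : AEStronglyMeasurable e volume := by
    refine AEStronglyMeasurable.indicator (AEStronglyMeasurable.sub ?_ hγm) hB
    exact (((WithLp.prod_continuous_ofLp 2 ℝ ℂ).comp hv₀c).fst.add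
      continuous_const).aestronglyMeasurable
  have hdm : AEStronglyMeasurable d volume := by
    refine AEStronglyMeasurable.indicator (AEStronglyMeasurable.sub ?_ hαm) hB
    exact ((WithLp.prod_continuous_ofLp 2 ℝ ℂ).comp hv₀c).snd.aestronglyMeasurable
  have heR (p : E3) (hp : R < ‖p‖) : e p = 0 := Set.indicator_of_notMem (hBR p hp) _
  have hdR (p : E3) (hp : R < ‖p‖) : d p = 0 := Set.indicator_of_notMem (hBR p hp) _
  have heC : ∀ᵐ p, ‖e p‖ ≤ 1 := by
    filter_upwards [hv0] with p hp
    refine (norm_indicator_le_norm_self _ _).trans ?_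
    have h1 := abs_le.1 ((abs_fst_le_norm _).trans (hv₀n p))
    have h2 := mem_Icc_of_norm_bcsVec_le hp
    rw [Real.norm_eq_abs, abs_le]
    constructor <;> linarith [h1.1, h1.2, h2.1, h2.2]
  have hdC : ∀ᵐ p, ‖d p‖ ≤ 1 := by
    filter_upwards [hv0] with p hp
    refine (norm_indicator_le_norm_self _ _).trans ((norm_sub_le _ _).trans ?_)
    have h1 := (norm_snd_le_norm _).trans (hv₀n p)
    have h2 := (norm_snd_le_norm _).trans hp
    have h3 : (bcsVec (γ p) (fourierHat α p)).snd = fourierHat α p := rfl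
    rw [h3] at h2
    linarith
  obtain ⟨η, hηd, hη, hη', hpars⟩ := exists_fourierHat_eq hdm hdC hdR
  have hvec (p : E3) : bcsVec (γ p + e p) (fourierHat α p + d p) =
      if p ∈ B then v₀ p else bcsVec (γ p) (fourierHat α p) := by
    by_cases hp : p ∈ B
    · rw [he, hd, Set.indicator_of_mem hp, Set.indicator_of_mem hp, add_sub_cancel, add_sub_cancel,
        bcsVec_fst_snd, if_pos hp]
    · rw [he, hd, Set.indicator_of_notMem hp, Set.indicator_of_notMem hp, add_zero, add_zero,
        if_neg hp]
  have hvd : ∀ᵐ p, ‖bcsVec (γ p + e p) (fourierHat α p + d p)‖ ≤ 1 / 2 := by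
    filter_upwards [hv0] with p hp
    rw [hvec]
    split_ifs
    · exact hv₀n p
    · exact hp
  have hvη : ∀ᵐ p, ‖bcsVec (γ p + e p) (fourierHat α p + fourierHat η p)‖ ≤ 1 / 2 := by
    filter_upwards [hvd, hηd] with p hp h
    rwa [h]
  have hei : Integrable (fun p : E3 => (1 + ‖p‖ ^ 2) * e p) volume :=
    integrable_mul_of_bounded_support (by fun_prop) hem heC heR
  have hγe : Integrable (fun p : E3 => (1 + ‖p‖ ^ 2) * (γ p + e p)) volume := by
    simpa only [mul_add] using! hγ.add hei
  have hlin := linearized_bcsFunctional_nonneg hV hβ hmem hmin hei hη hη' hvη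
  have hS0 := integrable_radialEntropy hγ hαm hv0
  have hS1 : Integrable (fun p => radialEntropy ‖bcsVec (γ p + e p) (fourierHat α p + d p)‖)
      volume := integrable_radialEntropy hγe (hαm.add hdm) hvd
  have hS1' : ∫ p, radialEntropy ‖bcsVec (γ p + e p) (fourierHat α p + fourierHat η p)‖ =
      ∫ p, radialEntropy ‖bcsVec (γ p + e p) (fourierHat α p + d p)‖ := by
    refine integral_congr_ae ?_
    filter_upwards [hηd] with p hp
    rw [hp]
  have hΔi : Integrable (fun p => conj (gapFunction V α p) * d p) volume :=
    integrable_mul_of_bounded_support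
      (Complex.continuous_conj.comp (continuous_gapFunction hVα)) hdm hdC hdR
  have hΔre : Integrable (fun p => (conj (gapFunction V α p) * d p).re) volume := hΔi.re
  -- The 2 from differentiating `|α|²` is the 2 in the definition of `Δ`.
  have hX : 2 * (∫ x, conj ((V x : ℂ) * α x) * η x).re =
      ∫ p, (conj (gapFunction V α p) * d p).re := by
    have h1 : ∫ p, (conj (gapFunction V α p) * d p).re = (∫ p, conj (gapFunction V α p) * d p).re :=
      integral_re hΔi
    rw [h1, hpars _ hVα]
    simp only [gapFunction, map_mul, Complex.conj_ofReal, mul_assoc]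
    rw [integral_const_mul, Complex.re_ofReal_mul, Complex.re_ofReal_mul, mul_assoc]
  set G : E3 → ℝ := fun p => (‖p‖ ^ 2 - μ) * e p + (conj (gapFunction V α p) * d p).re +
    1 / β * (radialEntropy ‖bcsVec (γ p + e p) (fourierHat α p + d p)‖ -
      radialEntropy ‖bcsVec (γ p) (fourierHat α p)‖) with hG
  have hi1 : Integrable (fun p : E3 => (‖p‖ ^ 2 - μ) * e p +
      (conj (gapFunction V α p) * d p).re) volume := (integrable_kinetic hei μ).add hΔre
  have hi2 : Integrable (fun p => 1 / β *
      (radialEntropy ‖bcsVec (γ p + e p) (fourierHat α p + d p)‖ -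
        radialEntropy ‖bcsVec (γ p) (fourierHat α p)‖)) volume := (hS1.sub hS0).const_mul _
  have hGi : Integrable G volume := hi1.add hi2
  have hGint : 0 ≤ ∫ p, G p := by
    rw [hG, integral_add hi1 hi2,
      integral_add (integrable_kinetic hei μ) hΔre, integral_const_mul, integral_sub hS1 hS0,
      ← hX, ← hS1']
    exact hlin
  -- The shift of `γ` by `1/2` inside `bcsVec` cancels in the difference.
  have hGeq (p : E3) : G p =
      (⟪w p, bcsVec (γ p + e p) (fourierHat α p + d p)⟫ +
        1 / β * radialEntropy ‖bcsVec (γ p + e p) (fourierHat α p + d p)‖) -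
      (⟪w p, bcsVec (γ p) (fourierHat α p)⟫ +
        1 / β * radialEntropy ‖bcsVec (γ p) (fourierHat α p)‖) := by
    rw [hw, bcsHamiltonian, inner_toLp_bcsVec, inner_toLp_bcsVec, hG, mul_add, Complex.add_re]
    ring
  have hGlt {p : E3} (hp : ‖bcsVec (γ p) (fourierHat α p)‖ ≤ 1 / 2) (hpB : p ∈ B)
      (hne : bcsVec (γ p) (fourierHat α p) ≠ v₀ p) : G p < 0 := by
    rw [hGeq, hvec, if_pos hpB]
    exact sub_neg.2 (gibbs_lt hβ (w p) hp hne)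
  have hGle : ∀ᵐ p, G p ≤ 0 := by
    filter_upwards [hv0] with p hp
    by_cases hpB : p ∈ B
    · by_cases hne : bcsVec (γ p) (fourierHat α p) = v₀ p
      · rw [hGeq, hvec, if_pos hpB, hne, sub_self]
      · exact (hGlt hp hpB hne).le
    · rw [hGeq, hvec, if_neg hpB, sub_self]
  -- A nonpositive function with nonnegative integral vanishes almost everywhere.
  have hG0 : ∀ᵐ p, G p = 0 := by
    have h0 : ∫ p, -G p = 0 := by
      rw [integral_neg, neg_eq_zero]
      exact le_antisymm (integral_nonpos_of_ae hGle) hGint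
    have h1 := (integral_eq_zero_iff_of_nonneg_ae (hGle.mono fun p hp => neg_nonneg.2 hp)
      hGi.neg).1 h0
    filter_upwards [h1] with p hp
    exact neg_eq_zero.1 hp
  filter_upwards [hv0, hG0] with p hp h0 hpR
  by_contra hne
  exact (hGlt hp (by simpa [B] using hpR) hne).ne h0

theorem mainTheorem8 (V : E3 → ℝ) (hV : MemLp V (3 / 2) (volume : Measure E3))
    (μ β : ℝ) (hβ : 0 < β) (γ : E3 → ℝ) (α : L2C) (hmem : (γ, α) ∈ bcsDomain)
    (hmin : ∀ y ∈ bcsDomain, bcsFunctional V μ β γ α ≤ bcsFunctional V μ β y.1 y.2) :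
    (∃ γc : E3 → ℝ, Continuous γc ∧ γ =ᵐ[volume] γc) ∧
      ∃ ac : E3 → ℂ, Continuous ac ∧ fourierHat α =ᵐ[volume] ac := by
  have hVα := integrable_potential_mul hV (mem_bcsDomain_iff.1 hmem).2.1
  have hc : Continuous fun p => WithLp.ofLp (gibbsPoint β (bcsHamiltonian V μ α p)) :=
    (WithLp.prod_continuous_ofLp 2 ℝ ℂ).comp
      ((continuous_gibbsPoint hβ).comp (continuous_bcsHamiltonian hVα μ))
  have hae : ∀ᵐ p, bcsVec (γ p) (fourierHat α p) = gibbsPoint β (bcsHamiltonian V μ α p) := by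
    -- Countably many balls exhaust momentum space, so the exceptional null sets can be united.
    have h : ∀ᵐ p : E3, ∀ n : ℕ, ‖p‖ ≤ n →
        bcsVec (γ p) (fourierHat α p) = gibbsPoint β (bcsHamiltonian V μ α p) :=
      ae_all_iff.2 fun n => ae_eq_gibbsPoint_of_norm_le hV hβ hmem hmin n
    filter_upwards [h] with p hp
    obtain ⟨n, hn⟩ := exists_nat_ge ‖p‖
    exact hp n hn
  refine ⟨⟨_, hc.fst.add (continuous_const (y := 1 / 2)), ?_⟩, ⟨_, hc.snd, ?_⟩⟩
  · filter_upwards [hae] with p hp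
    rw [Pi.add_apply, ← hp]
    simp [bcsVec]
  · filter_upwards [hae] with p hp
    rw [← hp]
    rfl
end
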